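/- Let $p$ be a prime, and let $L=(\mathbb{Q}_p,+)\rtimes\mathbb{Q}_p^*$ be the semidirect product in which the multiplicative group $\mathbb{Q}_p^*=\mathbb{Q}_p\setminus\{0\}$ acts on the additive group $\mathbb{Q}_p$ by multiplication, endowed with the product of the $p$-adic topologies. Then $L$ is hereditarily locally minimal, that is, every (not necessarily closed) subgroup of $L$ is locally minimal in the subspace topology. Here a Hausdorff topological group $(G,\tau)$ is called locally minimal if there is a $\tau$-neighbourhood $V$ of the identity such that every Hausdorff group topology $\sigma\subseteq\tau$ on $G$ for which $V$ is a $\sigma$-neighbourhood of the identity coincides with $\tau$. -/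

import Mathlib

/-- A topological group `(G, τ)` is *locally minimal* if it is a Hausdorff topological group and
there is a neighbourhood `V` of the identity such that every Hausdorff group topology `σ` on `G`
that is coarser than `τ` and for which `V` is still a neighbourhood of the identity equals `τ`.
(In Mathlib's order on topologies, `τ ≤ σ` says that every `σ`-open set is `τ`-open.) -/
structure IsLocallyMinimal (G : Type*) [Group G] [τ : TopologicalSpace G] : Prop where
  isTopologicalGroup : IsTopologicalGroup G
  t2Space : T2Space G
  exists_nhds : ∃ V ∈ nhds (1 : G), ∀ σ : TopologicalSpace G,
    @IsTopologicalGroup G σ _ → @T2Space G σ → τ ≤ σ → V ∈ @nhds G σ 1 → σ = τ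

/-- `G` is *hereditarily locally minimal* if each of its subgroups, with the subspace topology,
is locally minimal. -/
def IsHereditarilyLocallyMinimal (G : Type*) [Group G] [TopologicalSpace G] : Prop :=
  ∀ H : Subgroup G, IsLocallyMinimal H

/-- The product topology on a semidirect product of groups. -/
instance SemidirectProduct.instTopologicalSpaceProd {N G : Type*} [Group N] [Group G]
    [TopologicalSpace N] [TopologicalSpace G] (φ : G →* MulAut N) :
    TopologicalSpace (SemidirectProduct N G φ) :=
  TopologicalSpace.induced (fun x => (x.left, x.right)) inferInstance

/-- The natural action, by multiplication, of the multiplicative group `Kˣ` of a field `K` on its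
additive group (written multiplicatively). -/
def unitsMulAut (K : Type*) [Field K] : Kˣ →* MulAut (Multiplicative K) where
  toFun u :=
    { toFun := fun x => Multiplicative.ofAdd ((u : K) * x.toAdd)
      invFun := fun x => Multiplicative.ofAdd (((u⁻¹ : Kˣ) : K) * x.toAdd)
      left_inv := fun x => by simp
      right_inv := fun x => by simp
      map_mul' := fun x y => by simp [mul_add] }
  map_one' := by ext x; simp
  map_mul' u v := by ext x; simp [mul_assoc]

/-- The group `(K, +) ⋊ Kˣ`, where `Kˣ` acts on `K` by multiplication. -/
abbrev AffineSemidirect (K : Type*) [Field K] : Type _ :=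
  SemidirectProduct (Multiplicative K) Kˣ (unitsMulAut K)

/-! For a coarser Hausdorff group topology `σ` on `H`, the cluster points in the whole group of the
`σ`-neighbourhood filter of `1` form a closed subgroup `N` of `closure H`, normalized by `H`, with
`N ⊓ H = ⊥`. If a compact neighbourhood `K` is a `σ`-neighbourhood, then `N ⊆ K`, and `N = ⊥` forces
`σ = τ`.

It remains to kill such `N`. If `H` contains a nontrivial translation, commutators with it give
translations in `N`, and closed subgroups of `ℚ_[p]` absorb small elements
(`eq_bot_of_translation_mem`). Otherwise `H` is abelian and, unless trivial, lies in a point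
stabilizer, a copy of `ℚ_[p]ˣ`; near `1`, powers of one unit are dense in a ball
(`eq_bot_of_forall_translation_notMem`). -/

open Filter Topology

/-! ### A compactness criterion for local minimality -/

theorem tendsto_mul_mul_inv_nhds_one {G : Type*} [Group G] [TopologicalSpace G] [IsTopologicalGroup G]
    (g : G) : Tendsto (fun q => g * q * g⁻¹) (𝓝 1) (𝓝 1) := by
  simpa only [mul_one, mul_inv_cancel] using (IsTopologicalGroup.continuous_conj g).tendsto 1

/-- If every closed subgroup of `K ∩ closure H` that is normalized by `H` and meets `H` trivially is
trivial, for some compact neighbourhood `K` of `1`, then `H` is locally minimal. -/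
theorem IsLocallyMinimal.of_forall_closed_subgroup {G : Type*} [Group G] [TopologicalSpace G]
    [IsTopologicalGroup G] [T2Space G] (H : Subgroup G) (K : Set G) (hK : IsCompact K)
    (hK1 : K ∈ 𝓝 (1 : G))
    (hess : ∀ N : Subgroup G, IsClosed (N : Set G) → (N : Set G) ⊆ K →
      (N : Set G) ⊆ closure (H : Set G) → (∀ h ∈ H, ∀ n ∈ N, h * n * h⁻¹ ∈ N) →
      N ⊓ H = ⊥ → N = ⊥) : IsLocallyMinimal H := by
  refine ⟨inferInstance, inferInstance, Subtype.val ⁻¹' K,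
    continuous_subtype_val.continuousAt.preimage_mem_nhds hK1, ?_⟩
  intro σ hσ hσ2 hle hV
  set F : Filter G := map (Subtype.val : H → G) (@nhds H σ 1) with hF
  have hFK : K ∈ F := hV
  have hcl : ∀ x, ClusterPt x F ↔ ∀ U ∈ @nhds H σ 1, x ∈ closure (Subtype.val '' U) := by
    intro x
    rw [clusterPt_iff_forall_mem_closure]
    constructor
    · intro h U hU
      exact h _ (image_mem_map hU)
    · intro h s hs
      exact closure_mono (Set.image_preimage_subset _ _) (h _ hs)
  let N : Subgroup G :=
    { carrier := {x | ClusterPt x F}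
      one_mem' := by
        rw [Set.mem_ofPred_eq, hcl]
        intro U hU
        exact subset_closure ⟨1, @mem_of_mem_nhds H σ _ _ hU, rfl⟩
      mul_mem' := by
        intro x y hx hy
        rw [Set.mem_ofPred_eq, hcl] at hx hy ⊢
        intro U hU
        have : Tendsto (fun q : H × H => q.1 * q.2) (@nhds H σ 1 ×ˢ @nhds H σ 1)
            (@nhds H σ 1) := by
          have h := @ContinuousMul.continuous_mul H σ _ hσ.toContinuousMul
          have h2 := (@Continuous.tendsto _ _ (@instTopologicalSpaceProd H H σ σ) σ _ h (1, 1))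
          rwa [@nhds_prod_eq H H σ σ, mul_one] at h2
        obtain ⟨A, hA, B, hB, hAB⟩ := mem_prod_iff.1 (this hU)
        refine map_mem_closure₂ continuous_mul (hx A hA) (hy B hB) ?_
        rintro _ ⟨a, ha, rfl⟩ _ ⟨b, hb, rfl⟩
        exact ⟨a * b, hAB (Set.mk_mem_prod ha hb), rfl⟩
      inv_mem' := by
        intro x hx
        rw [Set.mem_ofPred_eq, hcl] at hx ⊢
        intro U hU
        have : Tendsto (fun q : H => q⁻¹) (@nhds H σ 1) (@nhds H σ 1) := by
          have h := @ContinuousInv.continuous_inv H σ _ hσ.toContinuousInv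
          have h2 := (@Continuous.tendsto _ _ σ σ _ h 1)
          rwa [inv_one] at h2
        refine map_mem_closure continuous_inv (hx _ (this hU)) ?_
        rintro _ ⟨a, ha, rfl⟩
        exact ⟨a⁻¹, ha, rfl⟩ }
  have hN : N = ⊥ := by
    apply hess
    · exact isClosed_setOfPred_clusterPt
    · intro x hx
      exact hK.isClosed.closure_eq ▸ (clusterPt_iff_forall_mem_closure.1 hx K hFK)
    · intro x hx
      refine closure_mono ?_ ((hcl x).1 hx Set.univ univ_mem)
      rintro _ ⟨a, -, rfl⟩
      exact a.2
    · intro h hh n hn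
      refine (hcl _).2 fun U hU => ?_
      have : Tendsto (fun q : H => ⟨h, hh⟩ * q * ⟨h, hh⟩⁻¹) (@nhds H σ 1) (@nhds H σ 1) :=
        @tendsto_mul_mul_inv_nhds_one H _ σ hσ ⟨h, hh⟩
      refine map_mem_closure (f := fun q => h * q * h⁻¹) (by fun_prop)
        ((hcl n).1 hn _ (this hU)) ?_
      rintro _ ⟨a, ha, rfl⟩
      exact ⟨_, ha, rfl⟩
    · rw [eq_bot_iff]
      rintro x ⟨hx, hxH⟩
      have h1 : ∀ U ∈ @nhds H σ 1, (⟨x, hxH⟩ : H) ∈ @closure H σ U := by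
        intro U hU
        have h2 := (hcl x).1 hx U hU
        -- Closures grow when passing to the coarser `σ`, so `x` is a `σ`-cluster point of the
        -- `σ`-neighbourhoods of `1`; `σ` being Hausdorff, `x = 1`.
        exact closure.mono (t₂ := σ) hle (closure_subtype (x := (⟨x, hxH⟩ : H)) |>.2 h2)
      have h4 := (@clusterPt_iff_forall_mem_closure H σ _ _).2 h1
      have h5 : (⟨x, hxH⟩ : H) = 1 := @eq_of_nhds_neBot H σ hσ2 _ _ h4
      exact congrArg Subtype.val h5
  -- A filter containing a compact set converges to its only possible cluster point.
  have hF1 : F ≤ 𝓝 1 := by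
    refine hK.le_nhds_of_unique_clusterPt hFK fun x _ hx => ?_
    have : x ∈ N := hx
    rwa [hN, Subgroup.mem_bot] at this
  refine IsTopologicalGroup.ext hσ inferInstance (le_antisymm ?_ (nhds_mono hle))
  rw [nhds_subtype_eq_comap]
  exact map_le_iff_le_comap.1 hF1

/-! ### Powers of `p`-adic units near `1` -/

theorem Padic.norm_natCast_le_one (p : ℕ) [Fact p.Prime] (n : ℕ) : ‖(n : ℚ_[p])‖ ≤ 1 := by
  simpa using Padic.norm_int_le_one (p := p) n

/-- First order expansion of `(1 + z) ^ n` in a nonarchimedean disc. -/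
theorem Padic.norm_one_add_pow_sub_le {p : ℕ} [Fact p.Prime] {z : ℚ_[p]} (hz : ‖z‖ ≤ 1) (n : ℕ) :
    ‖(1 + z) ^ n - 1 - n * z‖ ≤ ‖z‖ ^ 2 := by
  induction n with
  | zero => simp
  | succ n ih =>
    have h : (1 + z) ^ (n + 1) - 1 - ((n + 1 : ℕ) : ℚ_[p]) * z =
        ((1 + z) ^ n - 1 - n * z) * (1 + z) + n * z ^ 2 := by push_cast; ring
    rw [h]
    have h1 : ‖1 + z‖ ≤ 1 := (Padic.nonarchimedean _ _).trans (by simp [hz])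
    refine (Padic.nonarchimedean _ _).trans (max_le ?_ ?_)
    · rw [norm_mul]
      exact (mul_le_of_le_one_right (norm_nonneg _) h1).trans ih
    · rw [norm_mul, norm_pow]
      exact mul_le_of_le_one_left (by positivity) (Padic.norm_natCast_le_one p n)

/-- With `z = u - 1`, the linear term `p * z` strictly dominates the error, which is at most `‖z‖ ^
2`. -/
theorem Padic.norm_pow_prime_sub_one {p : ℕ} [Fact p.Prime] {u : ℚ_[p]}
    (hu : ‖u - 1‖ < (p : ℝ)⁻¹) : ‖u ^ p - 1‖ = (p : ℝ)⁻¹ * ‖u - 1‖ := by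
  obtain ⟨z, rfl⟩ : ∃ z, u = 1 + z := ⟨u - 1, by ring⟩
  rw [add_sub_cancel_left] at hu ⊢
  have hp : (p : ℝ)⁻¹ < 1 := inv_lt_one_of_one_lt₀ (by exact_mod_cast (Fact.out : p.Prime).one_lt)
  rcases eq_or_ne z 0 with rfl | hz
  · simp
  have hz' : 0 < ‖z‖ := norm_pos_iff.2 hz
  have h1 := Padic.norm_one_add_pow_sub_le (hu.le.trans hp.le) p
  have h2 : ‖(p : ℚ_[p]) * z‖ = (p : ℝ)⁻¹ * ‖z‖ := by rw [norm_mul, Padic.norm_p]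
  have h3 : ‖(1 + z) ^ p - 1 - p * z‖ < ‖(p : ℚ_[p]) * z‖ := by
    rw [h2]; refine h1.trans_lt ?_
    rw [sq]; exact mul_lt_mul_of_pos_right hu hz'
  have h4 : (1 + z) ^ p - 1 = ((1 + z) ^ p - 1 - p * z) + p * z := by ring
  rw [h4, Padic.add_eq_max_of_ne h3.ne, max_eq_right h3.le, h2]

theorem Padic.norm_pow_prime_pow_sub_one {p : ℕ} [Fact p.Prime] {u : ℚ_[p]}
    (hu : ‖u - 1‖ < (p : ℝ)⁻¹) (j : ℕ) : ‖u ^ p ^ j - 1‖ = (p : ℝ)⁻¹ ^ j * ‖u - 1‖ := by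
  have hp : (p : ℝ)⁻¹ ≤ 1 := (inv_lt_one_of_one_lt₀
    (by exact_mod_cast (Fact.out : p.Prime).one_lt)).le
  induction j with
  | zero => simp
  | succ j ih =>
    rw [pow_succ p, pow_mul, Padic.norm_pow_prime_sub_one, ih, pow_succ']
    · ring
    · rw [ih]
      exact (mul_le_of_le_one_left (norm_nonneg _) (pow_le_one₀ (by positivity) hp)).trans_lt hu

theorem Padic.exists_natCast_norm_sub_le {p : ℕ} [Fact p.Prime] {x : ℚ_[p]} (hx : ‖x‖ ≤ 1) :
    ∃ n : ℕ, ‖x - n‖ ≤ (p : ℝ)⁻¹ := by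
  obtain ⟨x, rfl⟩ : ∃ y : ℤ_[p], (y : ℚ_[p]) = x := ⟨⟨x, hx⟩, rfl⟩
  refine ⟨PadicInt.appr x 1, ?_⟩
  have h := PadicInt.appr_spec 1 x
  rw [← PadicInt.norm_le_pow_iff_mem_span_pow, PadicInt.norm_def] at h
  simpa only [PadicInt.coe_sub, PadicInt.coe_natCast, Nat.cast_one, zpow_neg_one] using h

/-- The powers of `u` approximate every `x` with `‖x - 1‖ ≤ ‖u - 1‖`. -/
theorem Padic.exists_pow_norm_sub_le {p : ℕ} [Fact p.Prime] {u x : ℚ_[p]}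
    (hu : ‖u - 1‖ < (p : ℝ)⁻¹) (hx : ‖x - 1‖ ≤ ‖u - 1‖) (j : ℕ) :
    ∃ e : ℕ, ‖x - u ^ e‖ ≤ (p : ℝ)⁻¹ ^ j * ‖u - 1‖ := by
  have hp : (p : ℝ)⁻¹ < 1 := inv_lt_one_of_one_lt₀ (by exact_mod_cast (Fact.out : p.Prime).one_lt)
  rcases eq_or_ne u 1 with rfl | hu1
  · exact ⟨0, by simpa using hx⟩
  have hnu : ‖u‖ = 1 := by
    have h : u = (u - 1) + 1 := by ring
    have h1 : ‖u - 1‖ < ‖(1 : ℚ_[p])‖ := by rw [norm_one]; exact hu.trans hp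
    rw [h, Padic.add_eq_max_of_ne h1.ne, max_eq_right h1.le, norm_one]
  induction j with
  | zero => exact ⟨0, by simpa using hx⟩
  | succ j ih =>
    obtain ⟨e, he⟩ := ih
    set v := u ^ p ^ j with hv
    have hvn : ‖v - 1‖ = (p : ℝ)⁻¹ ^ j * ‖u - 1‖ := Padic.norm_pow_prime_pow_sub_one hu j
    have hv0 : 0 < ‖v - 1‖ := by
      rw [hvn]
      have : 0 < ‖u - 1‖ := norm_pos_iff.2 (sub_ne_zero.2 hu1)
      have : (0 : ℝ) < p := by exact_mod_cast (Fact.out : p.Prime).pos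
      positivity
    have hvp : ‖v - 1‖ ≤ (p : ℝ)⁻¹ := by
      rw [hvn]
      exact (mul_le_of_le_one_left (norm_nonneg _) (pow_le_one₀ (by positivity) hp.le)).trans hu.le
    have hu0 : u ≠ 0 := by rintro rfl; simp at hnu
    have hvz : v - 1 ≠ 0 := norm_pos_iff.1 hv0
    have hw : ‖(x - u ^ e) / u ^ e / (v - 1)‖ ≤ 1 := by
      rw [norm_div, norm_div, norm_pow, hnu, one_pow, div_one]
      exact div_le_one_of_le₀ (he.trans hvn.ge) hv0.le
    -- Since `v ^ c` is `1 + c * (v - 1)` up to `‖v - 1‖ ^ 2`, correcting `u ^ e` by `v ^ c` gains a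
    -- factor `p⁻¹` when `c` is this quotient modulo `p`.
    obtain ⟨c, hc⟩ := Padic.exists_natCast_norm_sub_le hw
    refine ⟨e + p ^ j * c, ?_⟩
    have h1 := Padic.norm_one_add_pow_sub_le (hvp.trans hp.le) c
    rw [add_sub_cancel] at h1
    have key : x - u ^ (e + p ^ j * c) =
        u ^ e * ((v - 1) * ((x - u ^ e) / u ^ e / (v - 1) - c) +
          -(v ^ c - 1 - c * (v - 1))) := by
      rw [pow_add, pow_mul, ← hv]
      field_simp
      ring
    rw [key, norm_mul, norm_pow, hnu, one_pow, one_mul, pow_succ', mul_assoc, ← hvn]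
    refine (Padic.nonarchimedean _ _).trans (max_le ?_ ?_)
    · rw [norm_mul, mul_comm]
      exact mul_le_mul_of_nonneg_right hc (norm_nonneg _)
    · rw [norm_neg]
      refine h1.trans ?_
      rw [sq]
      exact mul_le_mul_of_nonneg_right hvp (norm_nonneg _)

theorem Padic.mem_closure_range_pow {p : ℕ} [Fact p.Prime] {u x : ℚ_[p]ˣ}
    (hu : ‖(u : ℚ_[p]) - 1‖ < (p : ℝ)⁻¹) (hx : ‖(x : ℚ_[p]) - 1‖ ≤ ‖(u : ℚ_[p]) - 1‖) :
    x ∈ closure (Set.range fun e : ℕ => u ^ e) := by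
  have hp : (p : ℝ)⁻¹ < 1 := inv_lt_one_of_one_lt₀ (by exact_mod_cast (Fact.out : p.Prime).one_lt)
  rw [Units.isEmbedding_val₀.toIsInducing.closure_eq_preimage_closure_image, Set.mem_preimage,
    Metric.mem_closure_iff]
  intro ε hε
  obtain ⟨j, hj⟩ := exists_pow_lt_of_lt_one hε hp
  obtain ⟨e, he⟩ := Padic.exists_pow_norm_sub_le hu hx j
  refine ⟨_, ⟨_, ⟨e, rfl⟩, rfl⟩, ?_⟩
  rw [dist_eq_norm, Units.val_pow_eq_pow_val]
  exact (he.trans (mul_le_of_le_one_right (by positivity) (hu.trans hp).le)).trans_lt hj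

/-- Density of `ℕ` in `ℤ_[p]` makes a closed additive subgroup a `ℤ_[p]`-submodule. -/
theorem Padic.mem_of_isClosed_addSubgroup {p : ℕ} [Fact p.Prime] (A : AddSubgroup ℚ_[p])
    (hA : IsClosed (A : Set ℚ_[p])) {s x : ℚ_[p]} (hs : s ∈ A) (hx : ‖x‖ ≤ ‖s‖) : x ∈ A := by
  rcases eq_or_ne s 0 with rfl | hs0
  · have : x = 0 := by simpa using hx
    rwa [this]
  have hc : ‖x / s‖ ≤ 1 := by rw [norm_div]; exact div_le_one_of_le₀ hx (norm_nonneg _)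
  have h : IsClosed {c : ℤ_[p] | (c : ℚ_[p]) * s ∈ A} :=
    hA.preimage (continuous_subtype_val.mul continuous_const)
  have h2 : ∀ c : ℤ_[p], c ∈ {c : ℤ_[p] | (c : ℚ_[p]) * s ∈ A} := by
    intro c
    refine PadicInt.denseRange_natCast.induction_on c h fun n => ?_
    simpa [← nsmul_eq_mul] using A.nsmul_mem hs n
  have h3 : x / s * s ∈ A := h2 ⟨x / s, hc⟩
  rwa [div_mul_cancel₀ _ hs0] at h3

/-! ### The affine group as a topological group -/

namespace AffineSemidirect

variable {K : Type*} [Field K]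

/-- The element `x ↦ a + u x` of the affine group. -/
abbrev ofPair (a : K) (u : Kˣ) : AffineSemidirect K := ⟨Multiplicative.ofAdd a, u⟩

theorem exists_eq_ofPair (g : AffineSemidirect K) : ∃ a u, g = ofPair a u :=
  ⟨g.left.toAdd, g.right, rfl⟩

theorem ofPair_inj {a b : K} {u v : Kˣ} : ofPair a u = ofPair b v ↔ a = b ∧ u = v := by
  rw [SemidirectProduct.ext_iff]; exact Iff.rfl

theorem one_eq : (1 : AffineSemidirect K) = ofPair 0 1 := rfl

theorem ofPair_mul_ofPair (a b : K) (u v : Kˣ) : ofPair a u * ofPair b v = ofPair (a + u * b) (u * v) := rfl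

theorem ofPair_inv (a : K) (u : Kˣ) : (ofPair a u)⁻¹ = ofPair (-((u⁻¹ : Kˣ) * a)) u⁻¹ := by
  rw [inv_eq_iff_mul_eq_one, ofPair_mul_ofPair, one_eq, ofPair_inj]
  simp

variable [TopologicalSpace K]

theorem isInducing_coords :
    IsInducing fun g : AffineSemidirect K => ((g.left.toAdd, g.right) : K × Kˣ) := ⟨rfl⟩

theorem continuous_ofPair : Continuous fun x : K × Kˣ => ofPair x.1 x.2 :=
  isInducing_coords.continuous_iff.2 continuous_id

theorem continuous_left : Continuous fun g : AffineSemidirect K => g.left.toAdd :=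
  continuous_fst.comp isInducing_coords.continuous

theorem continuous_right : Continuous fun g : AffineSemidirect K => g.right :=
  continuous_snd.comp isInducing_coords.continuous

instance [T2Space K] : T2Space (AffineSemidirect K) :=
  T2Space.of_injective_continuous (f := fun g : AffineSemidirect K => (g.left.toAdd, g.right))
    (fun _ _ h => SemidirectProduct.ext (Prod.ext_iff.1 h).1 (Prod.ext_iff.1 h).2)
    isInducing_coords.continuous

instance [IsTopologicalRing K] : IsTopologicalGroup (AffineSemidirect K) where
  continuous_mul := by
    have h : Continuous fun x : AffineSemidirect K × AffineSemidirect K =>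
        ofPair (x.1.left.toAdd + x.1.right * x.2.left.toAdd) (x.1.right * x.2.right) := by
      refine continuous_ofPair.comp (Continuous.prodMk ?_ ?_)
      · exact (continuous_left.comp continuous_fst).add
          ((Units.continuous_val.comp (continuous_right.comp continuous_fst)).mul
            (continuous_left.comp continuous_snd))
      · exact (continuous_right.comp continuous_fst).mul (continuous_right.comp continuous_snd)
    exact h
  continuous_inv := by
    have h : Continuous fun x : AffineSemidirect K =>
        ofPair (-((x.right⁻¹ : Kˣ) * x.left.toAdd)) x.right⁻¹ := by
      refine continuous_ofPair.comp (Continuous.prodMk ?_ continuous_right.inv)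
      exact ((Units.continuous_val.comp continuous_right.inv).mul continuous_left).neg
    convert h using 2 with x
    exact ofPair_inv _ _

end AffineSemidirect

/-! ### The compact neighbourhood of the identity -/

open AffineSemidirect

/-- The elements `x ↦ a + u x` with `‖a‖ ≤ 1` and `‖u - 1‖ ≤ p⁻²`. -/
def padicAffineBall (p : ℕ) [Fact p.Prime] : Set (AffineSemidirect ℚ_[p]) :=
  (fun g => ((g.left.toAdd, g.right) : ℚ_[p] × ℚ_[p]ˣ)) ⁻¹'
    (Metric.closedBall 0 1 ×ˢ (Units.val ⁻¹' Metric.closedBall 1 ((p : ℝ)⁻¹ ^ 2)))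

section padicAffineBall

variable {p : ℕ} [Fact p.Prime]

theorem inv_sq_lt_inv_prime : (p : ℝ)⁻¹ ^ 2 < (p : ℝ)⁻¹ := by
  have h0 : (0 : ℝ) < p := by exact_mod_cast (Fact.out : p.Prime).pos
  have hp : (p : ℝ)⁻¹ < 1 := inv_lt_one_of_one_lt₀ (by exact_mod_cast (Fact.out : p.Prime).one_lt)
  rw [sq]
  exact mul_lt_of_lt_one_left (by positivity) hp

theorem padicAffineBall_mem_nhds_one : padicAffineBall p ∈ 𝓝 1 := by
  have h0 : (0 : ℝ) < p := by exact_mod_cast (Fact.out : p.Prime).pos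
  refine isInducing_coords.continuous.continuousAt.preimage_mem_nhds (prod_mem_nhds ?_ ?_)
  · exact Metric.closedBall_mem_nhds _ one_pos
  · exact Units.continuous_val.continuousAt.preimage_mem_nhds
      (Metric.closedBall_mem_nhds _ (by positivity))

theorem isCompact_padicAffineBall : IsCompact (padicAffineBall p) := by
  have h1 : IsCompact (Units.val ⁻¹' Metric.closedBall (1 : ℚ_[p]) ((p : ℝ)⁻¹ ^ 2)) := by
    have hp : (p : ℝ)⁻¹ < 1 :=
      inv_lt_one_of_one_lt₀ (by exact_mod_cast (Fact.out : p.Prime).one_lt)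
    rw [Units.isEmbedding_val₀.toIsInducing.isCompact_iff, Set.image_preimage_eq_of_subset]
    · exact isCompact_closedBall _ _
    · intro x hx
      have hx0 : x ≠ 0 := by
        rintro rfl
        rw [mem_closedBall_iff_norm, zero_sub, norm_neg, norm_one] at hx
        linarith [inv_sq_lt_inv_prime (p := p)]
      exact ⟨Units.mk0 x hx0, rfl⟩
  have h2 := ((isCompact_closedBall (0 : ℚ_[p]) 1).prod h1).image continuous_ofPair
  convert h2 using 1
  ext g
  constructor
  · intro hg
    exact ⟨_, hg, rfl⟩
  · rintro ⟨x, hx, rfl⟩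
    exact hx

end padicAffineBall

/-! ### Triviality of `N` -/

section closedSubgroups

variable {p : ℕ} [Fact p.Prime] {H N : Subgroup (AffineSemidirect ℚ_[p])}

/-- A closed subgroup containing a nontrivial translation meets every subgroup with this property. -/
theorem exists_translation_mem_inf (hN : IsClosed (N : Set (AffineSemidirect ℚ_[p])))
    {s t : ℚ_[p]} (hs0 : s ≠ 0) (hs : ofPair s 1 ∈ N) (ht0 : t ≠ 0) (ht : ofPair t 1 ∈ H) :
    ∃ x : ℚ_[p], x ≠ 0 ∧ ofPair x 1 ∈ N ⊓ H := by
  have hp : (p : ℝ)⁻¹ < 1 := inv_lt_one_of_one_lt₀ (by exact_mod_cast (Fact.out : p.Prime).one_lt)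
  let A : Subgroup (AffineSemidirect ℚ_[p]) → AddSubgroup ℚ_[p] := fun M =>
    { carrier := {x | ofPair x 1 ∈ M}
      zero_mem' := M.one_mem
      add_mem' := by
        intro a b ha hb
        simpa [ofPair_mul_ofPair] using M.mul_mem ha hb
      neg_mem' := by
        intro a ha
        simpa [ofPair_inv] using M.inv_mem ha }
  have hA : IsClosed (A N : Set ℚ_[p]) :=
    hN.preimage (continuous_ofPair.comp (continuous_id.prodMk continuous_const))
  have ht' : 0 < ‖t‖ := norm_pos_iff.2 ht0
  obtain ⟨j, hj⟩ := exists_pow_lt_of_lt_one (div_pos (norm_pos_iff.2 hs0) ht') hp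
  have hp0 : (p : ℚ_[p]) ≠ 0 := by exact_mod_cast (Fact.out : p.Prime).ne_zero
  refine ⟨(p : ℚ_[p]) ^ j * t, mul_ne_zero (pow_ne_zero _ hp0) ht0, ?_, ?_⟩
  · refine Padic.mem_of_isClosed_addSubgroup (A N) hA hs ?_
    rw [norm_mul, norm_pow, Padic.norm_p]
    exact ((lt_div_iff₀ ht').1 hj).le
  · have h : (p ^ j) • t ∈ A H := (A H).nsmul_mem ht _
    rw [nsmul_eq_mul] at h
    push_cast at h
    exact h

theorem eq_bot_of_translation_mem (hN : IsClosed (N : Set (AffineSemidirect ℚ_[p])))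
    (hnorm : ∀ h ∈ H, ∀ n ∈ N, h * n * h⁻¹ ∈ N) (hNH : N ⊓ H = ⊥)
    {t : ℚ_[p]} (ht0 : t ≠ 0) (ht : ofPair t 1 ∈ H) : N = ⊥ := by
  have htr : ∀ s : ℚ_[p], ofPair s 1 ∈ N → s = 0 := by
    intro s hs
    by_contra hs0
    obtain ⟨x, hx0, hx⟩ := exists_translation_mem_inf hN hs0 hs ht0 ht
    rw [hNH, Subgroup.mem_bot, one_eq, ofPair_inj] at hx
    exact hx0 hx.1
  rw [eq_bot_iff]
  intro n hn
  obtain ⟨a, u, rfl⟩ := exists_eq_ofPair n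
  have h := N.mul_mem hn (hnorm _ ht _ (N.inv_mem hn))
  -- The commutator of an element of `N` with the translation by `t` lies in `N` by normality.
  have h2 : ofPair a u * (ofPair t 1 * (ofPair a u)⁻¹ * (ofPair t 1)⁻¹) = ofPair ((u - 1) * t) 1 := by
    simp only [ofPair_inv, ofPair_mul_ofPair, ofPair_inj]
    constructor
    · simp only [Units.val_mul, Units.val_one, inv_one]
      linear_combination (-a - t) * u.mul_inv
    · simp
  rw [h2] at h
  have hu : u = 1 := by
    have := htr _ h
    rcases mul_eq_zero.1 this with h | h
    · exact Units.ext (sub_eq_zero.1 h)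
    · exact absurd h ht0
  subst hu
  rw [htr a hn]
  exact Subgroup.one_mem _

theorem eq_bot_of_forall_translation_notMem (hN : IsClosed (N : Set (AffineSemidirect ℚ_[p])))
    (hNK : (N : Set (AffineSemidirect ℚ_[p])) ⊆ padicAffineBall p)
    (hNcl : (N : Set (AffineSemidirect ℚ_[p])) ⊆ closure (H : Set (AffineSemidirect ℚ_[p])))
    (hNH : N ⊓ H = ⊥) (htriv : ∀ t : ℚ_[p], ofPair t 1 ∈ H → t = 0) : N = ⊥ := by
  by_cases hH : ∀ a u, ofPair a u ∈ H → u = 1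
  · have hb : H = ⊥ := by
      rw [eq_bot_iff]
      intro h hh
      obtain ⟨a, u, rfl⟩ := exists_eq_ofPair h
      obtain rfl := hH a u hh
      rw [htriv a hh]
      exact Subgroup.one_mem _
    rw [eq_bot_iff]
    intro n hn
    have := hNcl hn
    rwa [hb, Subgroup.coe_bot, closure_singleton] at this
  push Not at hH
  obtain ⟨b, v, hbv, hv⟩ := hH
  have hv' : (1 - v : ℚ_[p]) ≠ 0 := sub_ne_zero.2 fun h => hv (Units.ext h.symm)
  -- all of `H` fixes the fixed point `c` of `x ↦ b + v x`
  set c : ℚ_[p] := b / (1 - v) with hc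
  have hb : b = c * (1 - v) := by rw [hc, div_mul_cancel₀ _ hv']
  have hHfix : ∀ g ∈ H, g.left.toAdd = c * (1 - (g.right : ℚ_[p])) := by
    intro g hg
    obtain ⟨a, u, rfl⟩ := exists_eq_ofPair g
    have h := H.mul_mem (H.mul_mem hg hbv) (H.mul_mem (H.inv_mem hg) (H.inv_mem hbv))
    -- A commutator is a translation, hence trivial here; its vanishing says that both maps fix `c`.
    have h2 : ofPair a u * ofPair b v * ((ofPair a u)⁻¹ * (ofPair b v)⁻¹) =
        ofPair (a * (1 - v) - b * (1 - u)) 1 := by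
      simp only [ofPair_inv, ofPair_mul_ofPair, ofPair_inj]
      constructor
      · push_cast
        field_simp
        ring
      · rw [mul_comm u v]; group
    rw [h2] at h
    have h3 := htriv _ h
    change a = c * (1 - (u : ℚ_[p]))
    rw [hb] at h3
    apply mul_right_cancel₀ hv'
    linear_combination h3
  have hcont : Continuous fun u : ℚ_[p]ˣ => c * (1 - (u : ℚ_[p])) :=
    by fun_prop
  have hNfix : ∀ g ∈ N, g.left.toAdd = c * (1 - (g.right : ℚ_[p])) := by
    intro g hg
    have hcl : IsClosed {g : AffineSemidirect ℚ_[p] |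
        g.left.toAdd = c * (1 - (g.right : ℚ_[p]))} :=
      isClosed_eq continuous_left (hcont.comp continuous_right)
    exact closure_minimal hHfix hcl (hNcl hg)
  let f : ℚ_[p]ˣ → AffineSemidirect ℚ_[p] := fun u => ofPair (c * (1 - (u : ℚ_[p]))) u
  have hf : Continuous f := continuous_ofPair.comp (hcont.prodMk continuous_id)
  have hfeq : ∀ g : AffineSemidirect ℚ_[p],
      g.left.toAdd = c * (1 - (g.right : ℚ_[p])) → g = f g.right := by
    intro g hg
    exact SemidirectProduct.ext hg rfl
  rw [eq_bot_iff]
  intro n hn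
  by_contra hn1
  set u := n.right with hu
  have hu1 : (u : ℚ_[p]) - 1 ≠ 0 := by
    intro h
    apply hn1
    have hu' : u = 1 := Units.ext (sub_eq_zero.1 h)
    rw [hfeq n (hNfix n hn), ← hu, hu', Subgroup.mem_bot, one_eq, ofPair_inj]
    simp
  have huK : ‖(u : ℚ_[p]) - 1‖ < (p : ℝ)⁻¹ := by
    have h := (hNK hn).2
    -- The radius `p⁻²` of the ball supplies the strict bound needed for density of powers.
    exact (mem_closedBall_iff_norm.1 h).trans_lt inv_sq_lt_inv_prime
  have hO : {g : AffineSemidirect ℚ_[p] |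
      ‖(g.right : ℚ_[p]) - u‖ < ‖(u : ℚ_[p]) - 1‖} ∈ 𝓝 n := by
    refine IsOpen.mem_nhds (isOpen_lt ?_ continuous_const) ?_
    · exact ((Units.continuous_val.comp continuous_right).sub continuous_const).norm
    · simpa [← hu] using norm_pos_iff.2 hu1
  -- An `h ∈ H` this close to `n` has `‖w - 1‖ = ‖u - 1‖`, so `w` is a limit of powers of `u` and
  -- `h` lies in the closed `N`.
  obtain ⟨h, hlt, hhH⟩ := mem_closure_iff_nhds.1 (hNcl hn) _ hO
  set w := h.right with hw
  have hlt' : ‖(w : ℚ_[p]) - u‖ < ‖(u : ℚ_[p]) - 1‖ := hlt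
  have hwn : ‖(w : ℚ_[p]) - 1‖ = ‖(u : ℚ_[p]) - 1‖ := by
    have e : (w : ℚ_[p]) - 1 = (w - u) + (u - 1) := by ring
    rw [e, Padic.add_eq_max_of_ne hlt'.ne, max_eq_right hlt'.le]
  have hwN : f w ∈ N := by
    have h1 := Padic.mem_closure_range_pow huK hwn.le
    refine closure_minimal ?_ (hN.preimage hf) h1
    rintro _ ⟨e, rfl⟩
    have h2 := N.pow_mem hn e
    have h3 : (n ^ e).right = u ^ e := map_pow SemidirectProduct.rightHom n e
    rw [hfeq _ (hNfix _ h2), h3] at h2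
    exact h2
  have hmem : h ∈ N ⊓ H := ⟨by rw [hfeq h (hHfix h hhH)]; exact hwN, hhH⟩
  rw [hNH, Subgroup.mem_bot] at hmem
  have hw1 : w = 1 := by rw [hw, hmem]; rfl
  rw [hw1, Units.val_one, sub_self, norm_zero] at hwn
  exact hu1 (norm_eq_zero.1 hwn.symm)

end closedSubgroups

theorem theoremA (p : ℕ) [Fact p.Prime] :
    IsHereditarilyLocallyMinimal (AffineSemidirect ℚ_[p]) := by
  intro H
  refine IsLocallyMinimal.of_forall_closed_subgroup H (padicAffineBall p)
    isCompact_padicAffineBall padicAffineBall_mem_nhds_one ?_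
  intro N hN hNK hNcl hnorm hNH
  by_cases h : ∃ t : ℚ_[p], t ≠ 0 ∧ ofPair t 1 ∈ H
  · obtain ⟨t, ht0, ht⟩ := h
    exact eq_bot_of_translation_mem hN hnorm hNH ht0 ht
  · push Not at h
    exact eq_bot_of_forall_translation_notMem hN hNK hNcl hNH
      fun t ht => by_contra fun ht0 => h t ht0 ht
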